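/- Let $K$ be a number field with ring of integers $O_K$, let $\pi$ be a nonzero prime ideal of $O_K$, let $O_K[\frac1\pi]$ be the ring of elements of $K$ that are integral at every prime of $O_K$ other than $\pi$, let $\ell$ be a prime number with $\ell\notin\pi$, and let $i\ge 0$ be a real number. Let $K_\pi$ be the completion of $K$ at $\pi$. For a finite Galois extension $L/K_\pi$ with Galois group $G$, valuation ring $O_L$ and normalized valuation $v_L$, put $G_s=\{\sigma\in G : v_L(\sigma x-x)\ge s+1 \text{ for all } x\in O_L\}$ for real $s\ge -1$, let $\varphi_{L/K_\pi}(u)=\int_0^u \frac{dt}{[G_0:G_t]}$ (so $\varphi_{L/K_\pi}(u)=u$ for $-1\le u\le 0$), and let $\mathrm{Gal}(L/K_\pi)^{v}=G_{\varphi_{L/K_\pi}^{-1}(v)}$. Let $\mathrm{Gal}(\overline{K}_\pi/K_\pi)^v=\varprojlim_L \mathrm{Gal}(L/K_\pi)^v$ be the ramification groups in the upper numbering. A commutative group scheme $J$ over $O_K[\frac1\pi]$ is called *ramified of level $i$ at $\pi$* if, for every $K$-embedding $\overline{K}\to\overline{K}_\pi$ and every real $v>i$, the group $\mathrm{Gal}(\overline{K}_\pi/K_\pi)^v$,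 mapped to $\mathrm{Gal}(\overline{K}/K)$ by restriction along this embedding, acts trivially on $J(\overline{K})$. Let $\mathscr{C}$ be the category of finite flat commutative group schemes over $O_K[\frac1\pi]$ whose order is a power of $\ell$ and that are ramified of level $i$ at $\pi$; its morphisms are the homomorphisms of group schemes over $O_K[\frac1\pi]$. A sequence $0\to N\to J\to Q\to 0$ of commutative group schemes over $O_K[\frac1\pi]$ is called exact if $J\to Q$ is faithfully flat and quasi-compact and $N\to J$ is its kernel; then $J$ is an *extension* of $Q$ by $N$, and $Q$ is a *quotient* of $J$ by $N$. Then: 1. If $0\to J''\to J\to J'\to 0$ is an exact sequence of commutative group schemes over $O_K[\frac1\pi]$ and $J''$ and $J'$ are in $\mathscr{C}$, then $J$ is in $\mathscr{C}$. 2. If $J$ is in $\mathscr{C}$ and $H\to J$ is a closed subgroup scheme that is flat over $O_K[\frac1\pi]$, then $H$ is in $\mathscr{C}$, and every quotient $Q$ of $J$ by $H$ is in $\mathscr{C}$. -/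

import Mathlib

open CategoryTheory AlgebraicGeometry MonoidalCategory CartesianMonoidalCategory
open NumberField IsDedekindDomain
open scoped MonObj

noncomputable section

universe u

/-! ### Ramification groups -/

section Ramification

variable (O F L : Type*) [CommRing O] [Field F] [Field L] [Algebra O F] [IsFractionRing O F]
  [Algebra F L] [Algebra O L] [IsScalarTower O F L] [Algebra.IsAlgebraic F L]

/-- The ramification group `G_s` (lower numbering, real index `s ≥ -1`) of a finite Galois extension
`L / F` of local fields, where `O` is the valuation ring of `F`: the `σ` with
`σ x - x ∈ 𝔪 ^ (⌈s⌉ + 1)` for all `x` in the valuation ring `B` of `L`, i.e. `v_L (σ x - x) ≥ s + 1`.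
Here `B` is the integral closure of `O` in `L`; as `B` is local, its maximal ideal `𝔪` is its
Jacobson radical. -/
def lowerRamificationGroup (s : ℝ) : Subgroup (L ≃ₐ[F] L) :=
  letI : MulSemiringAction (L ≃ₐ[F] L) (integralClosure O L) :=
    IsIntegralClosure.MulSemiringAction O F L (integralClosure O L)
  ((Ring.jacobson (integralClosure O L)) ^ ⌈s + 1⌉₊).inertia (L ≃ₐ[F] L)

/-- The Herbrand function `φ(u) = ∫₀ᵘ dt / [G_0 : G_t]`. For `-1 < t ≤ 0` the integrand is `1`, so
that `φ(u) = u` for `-1 ≤ u ≤ 0`. -/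
def herbrandPhi (u : ℝ) : ℝ :=
  ∫ t in (0 : ℝ)..u, (((lowerRamificationGroup O F L t).relIndex
    (lowerRamificationGroup O F L 0) : ℕ) : ℝ)⁻¹

/-- The inverse `ψ` of the Herbrand function, which is an increasing bijection of the real line
for a finite extension. -/
def herbrandPsi : ℝ → ℝ := Function.invFun (herbrandPhi O F L)

/-- The ramification group with upper numbering `G^v = G_{ψ(v)}` of a finite Galois extension. -/
def upperRamificationGroup (v : ℝ) : Subgroup (L ≃ₐ[F] L) :=
  lowerRamificationGroup O F L (herbrandPsi O F L v)

end Ramification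

section AbsoluteRamification

variable (O F : Type*) [CommRing O] [Field F] [Algebra O F] [IsFractionRing O F]

/-- The ramification group with upper numbering `G^v` of the absolute Galois group of the local
field `F` with valuation ring `O`: the inverse limit of the groups `Gal(L/F)^v` over the finite
Galois extensions `L / F`. -/
def absoluteUpperRamificationGroup (v : ℝ) :
    Subgroup (AlgebraicClosure F ≃ₐ[F] AlgebraicClosure F) :=
  ⨅ L : FiniteGaloisIntermediateField F (AlgebraicClosure F),
    (upperRamificationGroup O F L v).comap (AlgEquiv.restrictNormalHom L)

/-- A representation `ρ` of the absolute Galois group of the local field `F` is ramified of level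
`i` if `ker ρ` contains the upper ramification groups `G^v` for all real `v > i`. -/
def IsRamifiedOfLevel {M : Type*} [Group M]
    (ρ : (AlgebraicClosure F ≃ₐ[F] AlgebraicClosure F) →* M) (i : ℝ) : Prop :=
  ∀ v : ℝ, i < v → absoluteUpperRamificationGroup O F v ≤ ρ.ker

end AbsoluteRamification

/-- Restriction of Galois groups `Gal(F̄/F) → Gal(K̄/K)` along a `K`-embedding `e : K̄ → F̄`.
If `F` is the completion of the number field `K` at a prime `𝔮`, this is an isomorphism onto a
decomposition group of `𝔮`, and every decomposition group of `𝔮` arises from some `e`. -/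
def galoisRestrict {K F : Type*} [Field K] [Field F] [Algebra K F]
    (e : AlgebraicClosure K →ₐ[K] AlgebraicClosure F) :
    (AlgebraicClosure F ≃ₐ[F] AlgebraicClosure F) →*
      (AlgebraicClosure K ≃ₐ[K] AlgebraicClosure K) :=
  letI : Algebra (AlgebraicClosure K) (AlgebraicClosure F) := e.toRingHom.toAlgebra
  haveI : IsScalarTower K (AlgebraicClosure K) (AlgebraicClosure F) :=
    IsScalarTower.of_algebraMap_eq' e.comp_algebraMap.symm
  (AlgEquiv.restrictNormalHom (AlgebraicClosure K)).comp (AlgEquiv.restrictScalarsHom K)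

theorem galoisRestrict_commutes {K F : Type*} [Field K] [Field F] [Algebra K F]
    (e : AlgebraicClosure K →ₐ[K] AlgebraicClosure F)
    (σ : AlgebraicClosure F ≃ₐ[F] AlgebraicClosure F) (x : AlgebraicClosure K) :
    e (galoisRestrict e σ x) = σ (e x) := by
  let : Algebra (AlgebraicClosure K) (AlgebraicClosure F) := e.toRingHom.toAlgebra
  have : IsScalarTower K (AlgebraicClosure K) (AlgebraicClosure F) :=
    IsScalarTower.of_algebraMap_eq' e.comp_algebraMap.symm
  exact AlgEquiv.restrictNormal_commutes (AlgEquiv.restrictScalars K σ) (AlgebraicClosure K) x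

/-! ### Group schemes over the ring of `π`-integers -/

section GroupSchemes

variable {K : Type u} [Field K] [NumberField K] (π : HeightOneSpectrum (𝓞 K))

/-- The ring `O_K[1/π]` of `π`-integers of `K`: the elements integral at all primes except `π`. -/
abbrev PiInteger : Type u := ({π} : Set (HeightOneSpectrum (𝓞 K))).integer K

/-- The category of commutative group schemes over `O_K[1/π]`. -/
abbrev CommGroupScheme : Type (u + 1) :=
  CommGrp (Over (Spec (CommRingCat.of (PiInteger π))))

/-- `Spec K̄` as a scheme over `O_K[1/π]`. -/
def geometricPoint : Over (Spec (CommRingCat.of (PiInteger π))) :=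
  Over.mk (Spec.map (CommRingCat.ofHom (algebraMap (PiInteger π) (AlgebraicClosure K))))

/-- The endomorphism of `Spec K̄` over `O_K[1/π]` induced by `σ ∈ Gal(K̄/K)`. -/
def geometricPointMap (σ : AlgebraicClosure K ≃ₐ[K] AlgebraicClosure K) :
    geometricPoint π ⟶ geometricPoint π :=
  Over.homMk (Spec.map (CommRingCat.ofHom (σ : AlgebraicClosure K →+* AlgebraicClosure K))) (by
    simp only [geometricPoint, Over.mk_hom, Over.mk_left, ← Spec.map_comp, ← CommRingCat.ofHom_comp]
    congr 2
    ext x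
    exact σ.commutes (x : K))

theorem geometricPointMap_one :
    geometricPointMap π (1 : AlgebraicClosure K ≃ₐ[K] AlgebraicClosure K) = 𝟙 _ :=
  Over.OverMorphism.ext (Spec.map_id _)

theorem geometricPointMap_mul (σ τ : AlgebraicClosure K ≃ₐ[K] AlgebraicClosure K) :
    geometricPointMap π (σ * τ) = geometricPointMap π σ ≫ geometricPointMap π τ :=
  Over.OverMorphism.ext (Spec.map_comp
    (CommRingCat.ofHom (τ : AlgebraicClosure K →+* AlgebraicClosure K))
    (CommRingCat.ofHom (σ : AlgebraicClosure K →+* AlgebraicClosure K)))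

variable {π}

/-- The representation `ρ_J : Gal(K̄/K) → Aut(J(K̄))` given by the natural action of the Galois group
on the group `J(K̄)` of geometric points. -/
def galoisRep (J : CommGroupScheme π) :
    (AlgebraicClosure K ≃ₐ[K] AlgebraicClosure K) →* MulAut (geometricPoint π ⟶ J.X) where
  toFun σ :=
    { toFun := fun P => geometricPointMap π σ ≫ P
      invFun := fun P => geometricPointMap π σ⁻¹ ≫ P
      left_inv := fun P => by
        change geometricPointMap π σ⁻¹ ≫ geometricPointMap π σ ≫ P = P
        rw [← Category.assoc, ← geometricPointMap_mul, inv_mul_cancel, geometricPointMap_one,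
          Category.id_comp]
      right_inv := fun P => by
        change geometricPointMap π σ ≫ geometricPointMap π σ⁻¹ ≫ P = P
        rw [← Category.assoc, ← geometricPointMap_mul, mul_inv_cancel, geometricPointMap_one,
          Category.id_comp]
      map_mul' := fun P Q => MonObj.comp_mul _ P Q }
  map_one' := by
    ext P : 1
    change geometricPointMap π 1 ≫ P = P
    rw [geometricPointMap_one, Category.id_comp]
  map_mul' σ τ := by
    ext P : 1
    change geometricPointMap π (σ * τ) ≫ P = geometricPointMap π σ ≫ geometricPointMap π τ ≫ P
    rw [geometricPointMap_mul, Category.assoc]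

/-- `J` is ramified of level `i` at the prime `𝔮` of `K`: the restriction of `ρ_J` to a
decomposition group of `𝔮` is ramified of level `i`. (All decomposition groups of `𝔮` are conjugate,
so that it does not matter whether one takes one or all of them.) -/
def CommGroupScheme.IsRamifiedOfLevelAt (J : CommGroupScheme π) (𝔮 : HeightOneSpectrum (𝓞 K))
    (i : ℝ) : Prop :=
  ∀ e : AlgebraicClosure K →ₐ[K] AlgebraicClosure (𝔮.adicCompletion K),
    IsRamifiedOfLevel (𝔮.adicCompletionIntegers K) (𝔮.adicCompletion K)
      ((galoisRep J).comp (galoisRestrict e)) i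

variable (π) in
/-- The objects of the category of finite flat commutative group schemes `J` over `O_K[1/π]` of
`ℓ`-power order (the rank of the structure sheaf is a power of `ℓ`) that are ramified of level `i`
at `π`. The category is the full subcategory of `CommGroupScheme π` on these objects. -/
structure IsLevelGroupScheme (ℓ : ℕ) (i : ℝ) (J : CommGroupScheme π) : Prop where
  isFinite : IsFinite J.X.hom
  flat : Flat J.X.hom
  order : ∃ n : ℕ, ∀ s, J.X.hom.finrank s = ℓ ^ n
  level : J.IsRamifiedOfLevelAt π i

/-- The underlying morphism of schemes of a homomorphism of group schemes. -/
abbrev CommGroupScheme.homLeft {G H : CommGroupScheme π} (f : G ⟶ H) : G.X.left ⟶ H.X.left :=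
  f.hom.hom.hom.left

/-- `0 ⟶ N ⟶ J ⟶ Q ⟶ 0` (with the given homomorphisms `f` and `g`) is a short exact sequence of
commutative group schemes: `f` is a kernel of `g`, i.e. `N` is the fibre product of `J` and the unit
section over `Q`, and `g` is faithfully flat and quasi-compact. In other words, `J` is an
extension of `Q` by `N`, and `Q` is a quotient of `J` by `N`. -/
structure IsShortExactSeq {N J Q : CommGroupScheme π} (f : N ⟶ J) (g : J ⟶ Q) : Prop where
  isKernel : IsPullback f.hom.hom.hom (toUnit N.X) g.hom.hom.hom η[Q.X]
  flat : Flat (CommGroupScheme.homLeft g)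
  surjective : Surjective (CommGroupScheme.homLeft g)
  quasiCompact : QuasiCompact (CommGroupScheme.homLeft g)

end GroupSchemes

end

/-!
Finite group schemes over a field of characteristic zero are étale (Cartier), so the order of a
finite flat group scheme is its number of geometric points. In an exact sequence `0 → N → J → Q → 0`
the morphism `J → Q` is a torsor under `N`; it is therefore finite if `N` is, by faithfully flat
descent, so that finiteness and flatness pass between `J` and `Q`. On geometric points the sequence
becomes an exact sequence of groups with Galois action. This settles everything except the level of
an extension.

For the latter, let `σ` be in `Gal(K̄_π/K_π)^v` with `v > i`. It acts trivially on the points of `N`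
and `Q`, so it moves a point `P` of `J` to `P * Z` with `Z` in `N`, whence `σ ^ #N` fixes `P`. Since
`v > 0`, the image of `σ` in every finite Galois group lies in the wild inertia group, where its
order is coprime to `ℓ`. As `#N` is a power of `ℓ`, already `σ` fixes `P`.
-/

section WildInertia

variable {B G : Type*} [CommRing B] [Group G] [MulSemiringAction G B] {I : Ideal B} {σ : G}

theorem smul_sub_mem_pow_add {n : ℕ} (hσ : σ ∈ (I ^ (n + 1)).inertia G) (j : ℕ) {a : B}
    (ha : a ∈ I ^ j) : σ • a - a ∈ I ^ (j + n) := by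
  induction j generalizing a with
  | zero => exact Ideal.pow_le_pow_right (by lia) (hσ a)
  | succ j ih =>
    rw [pow_succ] at ha
    induction ha using Submodule.mul_induction_on' with
    | mem_mul_mem b hb c hc =>
      have smul_b_mem : σ • b ∈ I ^ j :=
        (Submodule.sub_mem_iff_left _ hb).1 (Ideal.pow_le_pow_right (by lia) (ih hb))
      have split : σ • (b * c) - b * c = σ • b * (σ • c - c) + (σ • b - b) * c := by
        rw [smul_mul']
        ring
      rw [split]
      refine add_mem ?_ ?_
      · rw [show j + 1 + n = j + (n + 1) by lia, pow_add]
        exact Ideal.mul_mem_mul smul_b_mem (hσ c)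
      · rw [show j + 1 + n = j + n + 1 by lia, pow_succ]
        exact Ideal.mul_mem_mul (ih hb) hc
    | add x _ y _ hx hy =>
      rw [smul_add, add_sub_add_comm]
      exact add_mem hx hy

theorem sub_mem_pow_succ_of_pow_eq_one (hσ : σ ∈ (I ^ 2).inertia G) {m : ℕ} (hm : IsUnit (m : B))
    (hσm : σ ^ m = 1) {x : B} {j : ℕ} (hx : σ • x - x ∈ I ^ j) : σ • x - x ∈ I ^ (j + 1) := by
  have telescope : ∑ i ∈ Finset.range m, σ ^ i • (σ • x - x) = 0 := by
    simp only [smul_sub, ← mul_smul, ← pow_succ]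
    rw [Finset.sum_range_sub (fun i => σ ^ i • x), hσm, pow_zero, sub_self]
  have congr_mod : ∑ i ∈ Finset.range m, (σ ^ i • (σ • x - x) - (σ • x - x)) ∈ I ^ (j + 1) :=
    sum_mem fun i _ => smul_sub_mem_pow_add (n := 1) (pow_mem hσ i) j hx
  rw [Finset.sum_sub_distrib, telescope, zero_sub, neg_mem_iff, Finset.sum_const,
    Finset.card_range, nsmul_eq_mul] at congr_mod
  exact (Ideal.unit_mul_mem_iff_mem _ hm).1 congr_mod

theorem smul_eq_of_pow_eq_one [IsNoetherianRing B] (hI : I ≤ Ideal.jacobson ⊥)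
    (hσ : σ ∈ (I ^ 2).inertia G) {m : ℕ} (hm : IsUnit (m : B)) (hσm : σ ^ m = 1) (x : B) :
    σ • x = x := by
  have sub_mem_pow : ∀ j, σ • x - x ∈ I ^ j := fun j => by
    induction j with
    | zero => simp
    | succ j ih => exact sub_mem_pow_succ_of_pow_eq_one hσ hm hσm ih
  have iInf_eq_bot := Ideal.iInf_pow_smul_eq_bot_of_le_jacobson (M := B) I hI
  simp only [smul_eq_mul, Ideal.mul_top] at iInf_eq_bot
  rw [← sub_eq_zero, ← Ideal.mem_bot, ← iInf_eq_bot, Submodule.mem_iInf]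
  exact sub_mem_pow

end WildInertia

section LocalRamification

variable (O F L : Type*) [CommRing O] [Field F] [Field L] [Algebra O F] [IsFractionRing O F]
  [Algebra F L] [Algebra O L] [IsScalarTower O F L]

theorem lowerRamificationGroup_antitone [Algebra.IsAlgebraic F L] :
    Antitone (lowerRamificationGroup O F L) := fun _ _ hst _ hσ x =>
  Ideal.pow_le_pow_right (Nat.ceil_mono (by linarith)) (hσ x)

variable {O F L} in
theorem eq_one_of_pow_eq_one_of_mem_lowerRamificationGroup [IsDomain O] [IsIntegrallyClosed O]
    [IsNoetherianRing O] [FiniteDimensional F L] [Algebra.IsSeparable F L]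
    {s : ℝ} (hs : 0 < s) {σ : L ≃ₐ[F] L} (hσ : σ ∈ lowerRamificationGroup O F L s)
    {m : ℕ} (hm : IsUnit (m : O)) (hσm : σ ^ m = 1) : σ = 1 := by
  let B := integralClosure O L
  let : MulSemiringAction (L ≃ₐ[F] L) B := IsIntegralClosure.MulSemiringAction O F L B
  have : IsNoetherianRing B := IsIntegralClosure.isNoetherianRing O F L B
  have isUnit_m : IsUnit (m : B) := by simpa using hm.map (algebraMap O B)
  have two_le : 2 ≤ ⌈s + 1⌉₊ := Nat.lt_ceil.2 (by push_cast; linarith)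
  have mem_inertia : σ ∈ (Ring.jacobson B ^ 2).inertia (L ≃ₐ[F] L) := fun x =>
    Ideal.pow_le_pow_right two_le (hσ x)
  apply (galRestrict O F L B).injective
  ext x : 1
  rw [map_one]
  exact smul_eq_of_pow_eq_one Ideal.jacobson_bot.ge mem_inertia isUnit_m hσm x

variable {O F L} in
theorem coprime_orderOf_of_mem_lowerRamificationGroup [IsDomain O] [IsIntegrallyClosed O]
    [IsNoetherianRing O] [FiniteDimensional F L] [Algebra.IsSeparable F L]
    {s : ℝ} (hs : 0 < s) {σ : L ≃ₐ[F] L} (hσ : σ ∈ lowerRamificationGroup O F L s)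
    {m : ℕ} (hm : IsUnit (m : O)) : m.Coprime (orderOf σ) := by
  set d := m.gcd (orderOf σ)
  have isUnit_d : IsUnit (d : O) :=
    isUnit_of_dvd_unit (Nat.cast_dvd_cast (Nat.gcd_dvd_left _ _)) hm
  have d_dvd : d ∣ orderOf σ := Nat.gcd_dvd_right _ _
  have pow_eq_one : σ ^ (orderOf σ / d) = 1 :=
    eq_one_of_pow_eq_one_of_mem_lowerRamificationGroup hs (pow_mem hσ _) isUnit_d
      (by rw [← pow_mul, Nat.div_mul_cancel d_dvd, pow_orderOf_eq_one])
  exact (Nat.div_eq_self.1 (Nat.dvd_antisymm (Nat.div_dvd_of_dvd d_dvd)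
    (orderOf_dvd_of_pow_eq_one pow_eq_one))).resolve_left (orderOf_pos σ).ne'

theorem intervalIntegrable_inv_relIndex [FiniteDimensional F L] (a b : ℝ) :
    IntervalIntegrable (fun t : ℝ => (((lowerRamificationGroup O F L t).relIndex
      (lowerRamificationGroup O F L 0) : ℕ) : ℝ)⁻¹) MeasureTheory.volume a b :=
  Antitone.intervalIntegrable fun s t hst => by
    have relIndex_pos (t : ℝ) : 0 < (lowerRamificationGroup O F L t).relIndex
      (lowerRamificationGroup O F L 0) := Nat.pos_of_ne_zero Subgroup.index_ne_zero_of_finite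
    exact inv_anti₀ (by exact_mod_cast relIndex_pos s) (by
      exact_mod_cast Subgroup.relIndex_le_of_le_left (lowerRamificationGroup_antitone O F L hst)
        (relIndex_pos t).ne')

theorem inv_card_le_inv_relIndex [FiniteDimensional F L] (t : ℝ) :
    (Nat.card (L ≃ₐ[F] L) : ℝ)⁻¹ ≤ (((lowerRamificationGroup O F L t).relIndex
      (lowerRamificationGroup O F L 0) : ℕ) : ℝ)⁻¹ := by
  refine inv_anti₀ (by exact_mod_cast Nat.pos_of_ne_zero Subgroup.index_ne_zero_of_finite) ?_
  exact_mod_cast (Nat.le_of_dvd Nat.card_pos (Subgroup.relIndex_dvd_card _ _)).trans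
    (Subgroup.card_le_card_group _)

theorem herbrandPhi_zero [Algebra.IsAlgebraic F L] : herbrandPhi O F L 0 = 0 :=
  intervalIntegral.integral_same

theorem continuous_herbrandPhi [FiniteDimensional F L] : Continuous (herbrandPhi O F L) :=
  intervalIntegral.continuous_primitive (intervalIntegrable_inv_relIndex O F L) 0

theorem herbrandPhi_sub_ge [FiniteDimensional F L] {a b : ℝ} (hab : a ≤ b) :
    (Nat.card (L ≃ₐ[F] L) : ℝ)⁻¹ * (b - a) ≤ herbrandPhi O F L b - herbrandPhi O F L a := by
  have integrable := intervalIntegrable_inv_relIndex O F L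
  rw [herbrandPhi, herbrandPhi, intervalIntegral.integral_interval_sub_left (integrable 0 b)
    (integrable 0 a), mul_comm, ← smul_eq_mul, ← intervalIntegral.integral_const]
  exact intervalIntegral.integral_mono_on hab intervalIntegrable_const (integrable a b)
    fun t _ => inv_card_le_inv_relIndex O F L t

theorem strictMono_herbrandPhi [FiniteDimensional F L] : StrictMono (herbrandPhi O F L) :=
  fun a b hab => sub_pos.1 <| (herbrandPhi_sub_ge O F L hab.le).trans_lt' <|
    mul_pos (inv_pos.2 (by exact_mod_cast Nat.card_pos)) (sub_pos.2 hab)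

theorem herbrandPhi_surjective [FiniteDimensional F L] :
    Function.Surjective (herbrandPhi O F L) := by
  have inv_card_pos : 0 < (Nat.card (L ≃ₐ[F] L) : ℝ)⁻¹ :=
    inv_pos.2 (by exact_mod_cast Nat.card_pos)
  refine (continuous_herbrandPhi O F L).surjective ?_ ?_
  · refine Filter.tendsto_atTop_mono' _ ?_ (Filter.tendsto_id.const_mul_atTop inv_card_pos)
    filter_upwards [Filter.eventually_ge_atTop 0] with u hu
    simpa [herbrandPhi_zero] using herbrandPhi_sub_ge O F L hu
  · refine Filter.tendsto_atBot_mono' _ ?_ (Filter.tendsto_id.const_mul_atBot inv_card_pos)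
    filter_upwards [Filter.eventually_le_atBot 0] with u hu
    simpa [herbrandPhi_zero] using herbrandPhi_sub_ge O F L hu

theorem herbrandPsi_pos [FiniteDimensional F L] {v : ℝ} (hv : 0 < v) :
    0 < herbrandPsi O F L v := by
  have phi_psi : herbrandPhi O F L (herbrandPsi O F L v) = v :=
    Function.rightInverse_invFun (herbrandPhi_surjective O F L) v
  rwa [← (strictMono_herbrandPhi O F L).lt_iff_lt, herbrandPhi_zero, phi_psi]

end LocalRamification

theorem eq_of_pow_eq_of_mem_absoluteUpperRamificationGroup {O F : Type*} [CommRing O] [Field F]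
    [PerfectField F] [Algebra O F] [IsFractionRing O F] [IsDomain O] [IsIntegrallyClosed O]
    [IsNoetherianRing O] {v : ℝ} (hv : 0 < v) {σ : AlgebraicClosure F ≃ₐ[F] AlgebraicClosure F}
    (hσ : σ ∈ absoluteUpperRamificationGroup O F v) {m : ℕ} (hm : IsUnit (m : O))
    {x : AlgebraicClosure F} (hx : (σ ^ m) x = x) : σ x = x := by
  let L := FiniteGaloisIntermediateField.adjoin F {x}
  let y : L := ⟨x, FiniteGaloisIntermediateField.subset_adjoin F {x} rfl⟩
  let τ : L ≃ₐ[F] L := AlgEquiv.restrictNormalHom L σ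
  have hτ : τ ∈ upperRamificationGroup O F L v := Subgroup.mem_iInf.1 hσ L
  have coe_pow_smul (n : ℕ) : ((τ ^ n • y : L) : AlgebraicClosure F) = (σ ^ n) x := by
    rw [← map_pow]
    exact AlgEquiv.restrictNormal_commutes (σ ^ n) L y
  obtain ⟨n, hn⟩ := exists_pow_eq_self_of_coprime
    (coprime_orderOf_of_mem_lowerRamificationGroup (herbrandPsi_pos O F L hv) hτ hm)
  have pow_m_mem : τ ^ m ∈ MulAction.stabilizer (L ≃ₐ[F] L) y :=
    Subtype.ext ((coe_pow_smul m).trans hx)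
  have smul_y : τ • y = y := hn ▸ pow_mem pow_m_mem n
  have sigma_x := coe_pow_smul 1
  rwa [pow_one, pow_one, smul_y, eq_comm] at sigma_x

theorem isUnit_natCast_adicCompletionIntegers {R : Type*} [CommRing R] [IsDedekindDomain R]
    (K : Type*) [Field K] [Algebra R K] [IsFractionRing R K] (π : HeightOneSpectrum R) {m : ℕ}
    (hm : (m : R) ∉ π.asIdeal) : IsUnit (m : π.adicCompletionIntegers K) := by
  rw [HeightOneSpectrum.adicCompletionIntegers.isUnit_iff_valued_eq_one]
  have valuation_eq_one := (π.valuation_eq_one_iff_notMem (K := K)).2 hm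
  rw [← π.valuedAdicCompletion_eq_valuation (K := K)] at valuation_eq_one
  simpa using valuation_eq_one

instance adicCompletion_charZero {R K : Type*} [CommRing R] [IsDedekindDomain R] [Field K]
    [CharZero K] [Algebra R K] [IsFractionRing R K] (π : HeightOneSpectrum R) :
    CharZero (π.adicCompletion K) :=
  charZero_of_injective_algebraMap (algebraMap K (π.adicCompletion K)).injective

section Cartier

open TensorProduct WithConv Coalgebra

section Derivation

variable {k A : Type*} [Field k] [CommRing A] [Algebra k A]

theorem exists_mul_pow_eq_zero [IsArtinianRing A] (φ : A →ₐ[k] k) {x : A} (hx : φ x = 0) :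
    ∃ (n : ℕ) (g : A), φ g = 1 ∧ g * x ^ n = 0 := by
  obtain ⟨n, y, hy⟩ := IsArtinian.exists_pow_succ_smul_dvd (M := A) x (1 : A)
  refine ⟨n, 1 - x * y, by simp [hx], ?_⟩
  simp only [Nat.succ_eq_add_one, smul_eq_mul, mul_one] at hy
  linear_combination -hy

/-- Differentiating `g * x ^ n = 0` and multiplying by `g` gives the relation
`n * g ^ 2 * D x * x ^ (n - 1) = 0`, so that in characteristic zero `n` could be lowered to `0` if
`φ (D x)` were nonzero. -/
theorem map_derivation_eq_zero [CharZero k] [IsArtinianRing A] (φ : A →ₐ[k] k)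
    (D : Derivation k A A) {x : A} (hx : φ x = 0) : φ (D x) = 0 := by
  by_contra hDx
  obtain ⟨n, g, hg, hgx⟩ := exists_mul_pow_eq_zero φ hx
  replace hg : φ g ≠ 0 := by simp [hg]
  induction n generalizing g with
  | zero => exact hg (by simpa using congrArg φ hgx)
  | succ n ih =>
    refine ih ((n + 1 : ℕ) * g ^ 2 * D x) ?_ ?_
    rotate_left
    · rw [map_mul, map_mul, map_pow, map_natCast]
      exact mul_ne_zero (mul_ne_zero (Nat.cast_ne_zero.2 n.succ_ne_zero) (pow_ne_zero 2 hg)) hDx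
    · have leibniz : D (g * x ^ (n + 1)) = 0 := by rw [hgx, map_zero]
      rw [D.leibniz, D.leibniz_pow] at leibniz
      simp only [smul_eq_mul, nsmul_eq_mul, Nat.add_sub_cancel] at leibniz
      linear_combination g * leibniz - D g * hgx

end Derivation

section HopfAlgebra

variable {R A : Type*} [CommRing R] [CommRing A] [HopfAlgebra R A]

theorem comp_antipode_mul_self {B : Type*} [CommRing B] [Algebra R B] (f : A →ₐ[R] B) :
    toConv (f.comp (HopfAlgebra.antipodeAlgHom R A)) * toConv f = 1 := by
  have comp_eq := AlgHom.comp_convMul_distrib f (toConv (HopfAlgebra.antipodeAlgHom R A))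
    (toConv (AlgHom.id R A))
  rw [AlgHom.antipode_id_cancel] at comp_eq
  exact (congrArg toConv comp_eq).symm.trans (by ext; simp)

theorem self_mul_comp_antipode {B : Type*} [CommRing B] [Algebra R B] (f : A →ₐ[R] B) :
    toConv f * toConv (f.comp (HopfAlgebra.antipodeAlgHom R A)) = 1 := by
  have comp_eq := AlgHom.comp_convMul_distrib f (toConv (AlgHom.id R A))
    (toConv (HopfAlgebra.antipodeAlgHom R A))
  rw [eq_comm, show toConv (AlgHom.id R A) * toConv (HopfAlgebra.antipodeAlgHom R A) = 1 from
    mul_inv_cancel (toConv (AlgHom.id R A))] at comp_eq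
  exact (congrArg toConv comp_eq).trans (by ext; simp)

/-- Two lifts `f`, `g` of the same homomorphism to a square-zero extension differ by `f⁻¹ * g` for
the convolution product, which sends the augmentation ideal into the square-zero ideal. -/
theorem formallyUnramified_of_isIdempotentElem_ker_counit
    (hI : IsIdempotentElem (RingHom.ker (Bialgebra.counitAlgHom R A))) :
    Algebra.FormallyUnramified R A := by
  refine Algebra.FormallyUnramified.iff_comp_injective.2 fun B _ _ J hJ f g hfg => ?_
  let S := HopfAlgebra.antipodeAlgHom R A
  let h : WithConv (A →ₐ[R] B) := toConv (f.comp S) * toConv g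
  have mk_h : (Ideal.Quotient.mkₐ R J).comp h.ofConv =
      (Algebra.ofId R (B ⧸ J)).comp (Bialgebra.counitAlgHom R A) := by
    rw [AlgHom.comp_convMul_distrib, ofConv_toConv, ofConv_toConv, ← hfg, ← AlgHom.comp_assoc,
      comp_antipode_mul_self]
    rfl
  have map_ker_le : (RingHom.ker (Bialgebra.counitAlgHom R A)).map h.ofConv ≤ J := by
    rw [Ideal.map_le_iff_le_comap]
    intro a ha
    rw [Ideal.mem_comap, ← Ideal.Quotient.eq_zero_iff_mem]
    simpa [RingHom.mem_ker.1 ha] using DFunLike.congr_fun mk_h a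
  have map_ker_eq_bot : (RingHom.ker (Bialgebra.counitAlgHom R A)).map h.ofConv = ⊥ := by
    rw [← hI.eq, Ideal.map_mul, eq_bot_iff, ← hJ, sq]
    exact Ideal.mul_mono map_ker_le map_ker_le
  have h_eq_one : h = 1 := by
    ext a
    have sub_mem : a - algebraMap R A (counit a) ∈ RingHom.ker (Bialgebra.counitAlgHom R A) := by
      simp [RingHom.mem_ker]
    have h_sub_eq_zero := Ideal.mem_map_of_mem h.ofConv sub_mem
    rw [map_ker_eq_bot, Ideal.mem_bot, map_sub, AlgHom.commutes, sub_eq_zero] at h_sub_eq_zero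
    exact h_sub_eq_zero
  exact toConv_injective (left_inv_eq_right_inv (self_mul_comp_antipode f) h_eq_one)

/-- The left-invariant vector field `(id ⊗ d) ∘ Δ` extending a tangent vector `d` at the
identity. -/
def leftInvariantDerivation (d : A →ₗ[R] R)
    (hd : ∀ a b, d (a * b) = counit (R := R) a • d b + counit (R := R) b • d a) :
    Derivation R A A :=
  Derivation.mk' ((TensorProduct.rid R A).toLinearMap ∘ₗ d.lTensor A ∘ₗ comul) fun a b => by
    let idCounit := (TensorProduct.rid R A).toLinearMap ∘ₗ (counit (R := R) (A := A)).lTensor A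
    let idTangent := (TensorProduct.rid R A).toLinearMap ∘ₗ d.lTensor A
    have leibniz (x y : A ⊗[R] A) :
        idTangent (x * y) = idCounit x * idTangent y + idCounit y * idTangent x := by
      induction x with
      | zero => simp
      | add x₁ x₂ hx₁ hx₂ => simp only [add_mul, mul_add, map_add, hx₁, hx₂]; abel
      | tmul a₁ a₂ =>
        induction y with
        | zero => simp
        | add y₁ y₂ hy₁ hy₂ => simp only [add_mul, mul_add, map_add, hy₁, hy₂]; abel
        | tmul b₁ b₂ =>
          simp only [Algebra.TensorProduct.tmul_mul_tmul, LinearMap.coe_comp,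
            LinearEquiv.coe_coe, Function.comp_apply, LinearMap.lTensor_tmul, hd, smul_eq_mul,
            rid_tmul, Algebra.smul_def, map_add, map_mul, idTangent, idCounit]
          ring
    have idCounit_comul (x : A) : idCounit (comul x) = x := by simp [idCounit]
    change idTangent (comul (a * b)) = a * idTangent (comul b) + b * idTangent (comul a)
    rw [Bialgebra.comul_mul, leibniz, idCounit_comul, idCounit_comul]

theorem counit_leftInvariantDerivation (d : A →ₗ[R] R)
    (hd : ∀ a b, d (a * b) = counit (R := R) a • d b + counit (R := R) b • d a) (a : A) :
    counit (leftInvariantDerivation d hd a) = d a := by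
  have apply_eq : leftInvariantDerivation d hd a =
      ∑ i ∈ (ℛ R a).index, d ((ℛ R a).right i) • (ℛ R a).left i := by
    change TensorProduct.rid R A (d.lTensor A (comul a)) = _
    rw [← (ℛ R a).eq]
    simp
  conv_rhs => rw [← sum_counit_smul (ℛ R a)]
  simp [apply_eq, mul_comm]

end HopfAlgebra

variable {k A : Type*} [Field k] [CharZero k] [CommRing A] [HopfAlgebra k A]

theorem isIdempotentElem_ker_counit [IsArtinianRing A] :
    IsIdempotentElem (RingHom.ker (Bialgebra.counitAlgHom k A)) := by
  let ε := Bialgebra.counitAlgHom k A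
  let I := RingHom.ker ε
  refine le_antisymm Ideal.mul_le_left fun y hy => ?_
  by_contra hy_notMem
  obtain ⟨f, hfy, hf⟩ :=
    Submodule.exists_le_ker_of_notMem (p := (I * I).restrictScalars k) hy_notMem
  let d : A →ₗ[k] k := f ∘ₗ (LinearMap.id - Algebra.linearMap k A ∘ₗ ε.toLinearMap)
  have hd (a b : A) : d (a * b) = counit (R := k) a • d b + counit (R := k) b • d a := by
    have mul_mem : (a - algebraMap k A (ε a)) * (b - algebraMap k A (ε b)) ∈ I * I :=
      Ideal.mul_mem_mul (by simp [I, RingHom.mem_ker]) (by simp [I, RingHom.mem_ker])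
    have split : a * b - algebraMap k A (ε (a * b)) =
        (a - algebraMap k A (ε a)) * (b - algebraMap k A (ε b)) +
          (ε a • (b - algebraMap k A (ε b)) + ε b • (a - algebraMap k A (ε a))) := by
      simp only [Algebra.smul_def, map_mul]
      ring
    have f_eq := congrArg f split
    rwa [map_add, hf mul_mem, zero_add, map_add, map_smul, map_smul] at f_eq
  have hdy : d y = f y := by simp [d, show ε y = 0 from hy]
  refine hfy ?_
  rw [← hdy, ← counit_leftInvariantDerivation d hd y]
  exact map_derivation_eq_zero ε _ hy

/-- **Cartier's theorem** for finite group schemes. -/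
theorem formallyUnramified_of_charZero [IsArtinianRing A] : Algebra.FormallyUnramified k A :=
  formallyUnramified_of_isIdempotentElem_ker_counit isIdempotentElem_ker_counit

theorem card_algHom_eq_finrank_of_formallyUnramified {k A : Type*} [Field k] [IsAlgClosed k]
    [CommRing A] [Algebra k A] [Module.Finite k A] [Algebra.FormallyUnramified k A] :
    Nat.card (A →ₐ[k] k) = Module.finrank k A := by
  have : Algebra.FormallyEtale k A := .of_formallyUnramified_of_field k A
  have : IsArtinianRing A := .of_finite k A
  have : Fintype (PrimeSpectrum A) := Fintype.ofFinite _
  let e : A ≃ₐ[k] (PrimeSpectrum A → k) := Algebra.FormallyEtale.equivPiOfIsSepClosed k A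
  let eval (p : PrimeSpectrum A) : A →ₐ[k] k := (Pi.evalAlgHom k _ p).comp e.toAlgHom
  have eval_injective : Function.Injective eval := fun p q hpq => by
    classical
    by_contra hne
    simpa [eval, hne] using DFunLike.congr_fun hpq (e.symm (Pi.single p 1))
  have finrank_eq : Module.finrank k A = Nat.card (PrimeSpectrum A) := by
    rw [e.toLinearEquiv.finrank_eq, Module.finrank_fintype_fun_eq_card, Nat.card_eq_fintype_card]
  refine le_antisymm (card_algHom_le_finrank k A k) ?_
  rw [finrank_eq]
  exact Nat.card_le_card_of_injective eval eval_injective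

theorem card_algHom_eq_finrank {R A k : Type*} [CommRing R] [CommRing A] [HopfAlgebra R A]
    [Module.Finite R A] [Field k] [IsAlgClosed k] [CharZero k] [Algebra R k] :
    Nat.card (A →ₐ[R] k) = Module.finrank k (k ⊗[R] A) := by
  have : IsArtinianRing (k ⊗[R] A) := .of_finite k _
  have : Algebra.FormallyUnramified k (k ⊗[R] A) := formallyUnramified_of_charZero
  rw [← card_algHom_eq_finrank_of_formallyUnramified,
    Nat.card_congr (AlgHom.liftEquiv R k A k)]

end Cartier

section AffinePoints

open TensorProduct Opposite

variable {R : Type u} [CommRing R]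

/-- The spectrum of an `R`-algebra as a scheme over `Spec R`. -/
noncomputable abbrev specOver (R A : Type u) [CommRing R] [CommRing A] [Algebra R A] :
    Over (Spec (CommRingCat.of R)) :=
  (algSpec (.of R)).obj (op (.of R A))

/-- The morphism of spectra over `Spec R` given by a homomorphism of `R`-algebras. -/
noncomputable abbrev specOverMap {A B : Type u} [CommRing A] [Algebra R A] [CommRing B]
    [Algebra R B] (f : A →ₐ[R] B) : specOver R B ⟶ specOver R A :=
  (algSpec (.of R)).map (CommAlgCat.ofHom f).op

theorem specOverMap_bijective (A B : Type u) [CommRing A] [Algebra R A] [CommRing B]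
    [Algebra R B] : Function.Bijective (specOverMap : (A →ₐ[R] B) → _) :=
  (algSpec.fullyFaithful.map_bijective _ _).comp
    (Quiver.Hom.opEquiv.bijective.comp
      (Function.bijective_iff_has_inverse.2 ⟨CommAlgCat.Hom.hom, fun _ => rfl, fun _ => rfl⟩))

theorem exists_specOver_iso (G : Over (Spec (CommRingCat.of R))) [IsAffineHom G.hom] :
    ∃ (A : Type u) (_ : CommRing A) (_ : Algebra R A), Nonempty (specOver R A ≅ G) := by
  obtain ⟨A, ⟨e⟩⟩ := essImage_algSpec.2 (isAffine_of_isAffineHom G.hom)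
  exact ⟨A.unop, inferInstance, inferInstance, ⟨e⟩⟩

theorem exists_hopfAlgebra_specOver_iso (G : Over (Spec (CommRingCat.of R))) [GrpObj G]
    [IsAffineHom G.hom] :
    ∃ (A : Type u) (_ : CommRing A) (_ : HopfAlgebra R A), Nonempty (specOver R A ≅ G) := by
  obtain ⟨A, ⟨e⟩⟩ := essImage_hopfSpec (G := .mk G).2 (isAffine_of_isAffineHom G.hom)
  exact ⟨A.unop, inferInstance, inferInstance, ⟨(Grp.forget _).mapIso e⟩⟩

/-- A geometric point is fixed by `σ` if and only if its coordinates are. -/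
theorem exists_specOverMap_comp_eq_iff {k : Type u} [CommRing k] [Algebra R k]
    (G : Over (Spec (CommRingCat.of R))) [IsAffineHom G.hom] (P : specOver R k ⟶ G) :
    ∃ T : Set k, ∀ σ : k →ₐ[R] k, specOverMap σ ≫ P = P ↔ ∀ y ∈ T, σ y = y := by
  obtain ⟨A, _, _, ⟨e⟩⟩ := exists_specOver_iso G
  obtain ⟨x, hx⟩ := (specOverMap_bijective A k).2 (P ≫ e.inv)
  refine ⟨Set.range x, fun σ => ?_⟩
  have comp_eq : specOverMap σ ≫ specOverMap x = specOverMap (σ.comp x) := by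
    rw [← Functor.map_comp]; rfl
  rw [← cancel_mono e.inv, Category.assoc, ← hx, comp_eq,
    (specOverMap_bijective A k).1.eq_iff, Set.forall_mem_range, AlgHom.ext_iff]
  rfl

section

variable {A : Type u} [CommRing A] [Algebra R A] {G : Over (Spec (CommRingCat.of R))}

theorem specMap_algebraMap_eq_comp (e : specOver R A ≅ G) :
    ∃ i : Spec (.of A) ⟶ G.left, IsIso i ∧
      Spec.map (CommRingCat.ofHom (algebraMap R A)) = i ≫ (G.hom : G.left ⟶ Spec (.of R)) :=
  ⟨e.hom.left, inferInstanceAs (IsIso ((Over.forget _).map e.hom)), (Over.w e.hom).symm⟩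

theorem moduleFinite_of_specOver_iso (e : specOver R A ≅ G) [hG : IsFinite G.hom] :
    Module.Finite R A := by
  obtain ⟨i, _, hi⟩ := specMap_algebraMap_eq_comp e
  rw [← RingHom.finite_algebraMap, ← CommRingCat.hom_ofHom (algebraMap R A),
    ← IsFinite.SpecMap_iff, hi]
  exact MorphismProperty.comp_mem @IsFinite i G.hom inferInstance hG

theorem moduleFlat_of_specOver_iso (e : specOver R A ≅ G) [hG : Flat G.hom] :
    Module.Flat R A := by
  obtain ⟨i, _, hi⟩ := specMap_algebraMap_eq_comp e
  rw [← RingHom.flat_algebraMap_iff, ← CommRingCat.hom_ofHom (algebraMap R A),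
    ← Flat.SpecMap_iff, hi]
  exact MorphismProperty.comp_mem @Flat i G.hom inferInstance hG

theorem finrank_hom_eq_rankAtStalk (e : specOver R A ≅ G) [IsFinite G.hom] [Flat G.hom]
    (s : PrimeSpectrum R) : G.hom.finrank s = Module.rankAtStalk A s := by
  have := moduleFinite_of_specOver_iso e
  have := moduleFlat_of_specOver_iso e
  obtain ⟨i, _, hi⟩ := specMap_algebraMap_eq_comp e
  rw [← Scheme.Hom.finrank_SpecMap_algebraMap R A s, hi]
  exact (congrFun (Scheme.Hom.finrank_comp_left_of_isIso i G.hom) s).symm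

end

theorem finrank_baseChange_eq_rankAtStalk [IsDomain R] (M k : Type*) [AddCommGroup M]
    [Module R M] [Module.FinitePresentation R M] [Module.Flat R M] [Field k] [Algebra R k]
    (s : PrimeSpectrum R) : Module.finrank k (k ⊗[R] M) = Module.rankAtStalk M s := by
  have at_bot := Module.rankAtStalk_baseChange (R := R) (M := M) (S := k) ⊥
  rw [Module.rankAtStalk_eq_finrank_of_free] at at_bot
  rw [(Module.isLocallyConstant_rankAtStalk (R := R) (M := M)).apply_eq_of_preconnectedSpace s
    ((⊥ : PrimeSpectrum k).comap (algebraMap R k))]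
  exact at_bot

theorem finrank_eq_card_points [IsDomain R] [IsNoetherianRing R] (k : Type u) [Field k]
    [IsAlgClosed k] [CharZero k] [Algebra R k] (G : Over (Spec (CommRingCat.of R))) [GrpObj G]
    [IsFinite G.hom] [Flat G.hom] (s : PrimeSpectrum R) :
    G.hom.finrank s = Nat.card (specOver R k ⟶ G) := by
  obtain ⟨A, _, _, ⟨e⟩⟩ := exists_hopfAlgebra_specOver_iso G
  have := moduleFinite_of_specOver_iso e
  have := moduleFlat_of_specOver_iso e
  have := Module.finitePresentation_of_finite R A
  calc
    G.hom.finrank s = Module.rankAtStalk A s := finrank_hom_eq_rankAtStalk e s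
    _ = Module.finrank k (k ⊗[R] A) := (finrank_baseChange_eq_rankAtStalk A k s).symm
    _ = Nat.card (A →ₐ[R] k) := card_algHom_eq_finrank.symm
    _ = Nat.card (specOver R k ⟶ G) :=
      Nat.card_congr ((Equiv.ofBijective _ (specOverMap_bijective A k)).trans e.homToEquiv)

end AffinePoints

section Descent

open Limits

variable {X Y Z P : Scheme.{u}}

theorem isSeparated_of_universallyClosed_diagonal (f : X ⟶ Y)
    [UniversallyClosed (pullback.diagonal f)] : IsSeparated f :=
  ⟨.of_isPreimmersion _ (pullback.diagonal f).isClosedMap.isClosed_range⟩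

theorem isFinite_of_isProper_of_finite_preimage_singleton (f : X ⟶ Y) [IsProper f]
    (hf : ∀ y, (f ⁻¹' {y}).Finite) : IsFinite f :=
  have : LocallyQuasiFinite f := .of_finite_preimage_singleton _ hf
  IsFinite.of_isProper_of_locallyQuasiFinite f

section IsPullback

variable {fst : P ⟶ X} {snd : P ⟶ Y} {f : X ⟶ Z} {g : Y ⟶ Z}

theorem isSeparated_of_isPullback (h : IsPullback fst snd f g)
    (hf : (@Surjective ⊓ @Flat ⊓ @QuasiCompact : MorphismProperty Scheme.{u}) f)
    [IsSeparated fst] : IsSeparated g := by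
  let uc : MorphismProperty Scheme.{u} := @UniversallyClosed
  let cover : MorphismProperty Scheme.{u} := @Surjective ⊓ @Flat ⊓ @QuasiCompact
  have : uc.DescendsAlong cover :=
    descendsAlong_universallyClosed_surjective_inf_flat_inf_quasicompact
  have : uc.RespectsIso := universallyClosed_respectsIso
  have : (@Surjective ⊓ @Flat : MorphismProperty Scheme.{u}).IsStableUnderBaseChange := .inf
  have : cover.IsStableUnderBaseChange := .inf
  have : UniversallyClosed (pullback.diagonal g) :=
    MorphismProperty.of_isPullback_of_descendsAlong (P := uc.diagonal) (Q := cover) h hf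
      (inferInstanceAs (UniversallyClosed (pullback.diagonal fst)))
  exact isSeparated_of_universallyClosed_diagonal g

theorem finite_preimage_singleton_of_isPullback (h : IsPullback fst snd f g) [Surjective f]
    (hfst : ∀ x, (fst ⁻¹' {x}).Finite) (z : Z) : (g ⁻¹' {z}).Finite := by
  obtain ⟨x, rfl⟩ := f.surjective z
  refine ((hfst x).image snd).subset fun y hy => ?_
  obtain ⟨p, hpx, hpy⟩ := Scheme.Pullback.exists_preimage_pullback x y hy.symm
  refine ⟨h.isoPullback.inv p, ?_, ?_⟩
  · rwa [Set.mem_preimage, ← Scheme.Hom.comp_apply, h.isoPullback_inv_fst]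
  · rwa [← Scheme.Hom.comp_apply, h.isoPullback_inv_snd]

theorem isFinite_of_isPullback (h : IsPullback fst snd f g) [Surjective f] [Flat f]
    [QuasiCompact f] [IsFinite fst] : IsFinite g := by
  have hf : (@Surjective ⊓ @Flat ⊓ @QuasiCompact : MorphismProperty Scheme.{u}) f :=
    ⟨⟨inferInstance, inferInstance⟩, inferInstance⟩
  have : UniversallyClosed g :=
    MorphismProperty.of_isPullback_of_descendsAlong (P := @UniversallyClosed) h hf inferInstance
  have : LocallyOfFiniteType g :=
    MorphismProperty.of_isPullback_of_descendsAlong (P := @LocallyOfFiniteType) h hf inferInstance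
  have : IsSeparated g := isSeparated_of_isPullback h hf
  have : IsProper g := {}
  exact isFinite_of_isProper_of_finite_preimage_singleton g
    (finite_preimage_singleton_of_isPullback h fst.finite_preimage_singleton)

end IsPullback

theorem stalkMap_faithfullyFlat (f : X ⟶ Y) [Flat f] (x : X) :
    (f.stalkMap x).hom.FaithfullyFlat := by
  algebraize [(f.stalkMap x).hom]
  have : Module.Flat (Y.presheaf.stalk (f x)) (X.presheaf.stalk x) := Flat.stalkMap f x
  have : IsLocalHom (algebraMap (Y.presheaf.stalk (f x)) (X.presheaf.stalk x)) :=
    f.toLRSHom.prop x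
  exact Module.FaithfullyFlat.of_flat_of_isLocalHom

theorem app_injective_of_flat_of_surjective (f : X ⟶ Y) [Flat f] [Surjective f] (V : Y.Opens) :
    Function.Injective (f.app V) := by
  intro s t hst
  refine TopCat.Presheaf.section_ext Y.sheaf V s t fun y hy => ?_
  obtain ⟨x, rfl⟩ := f.surjective y
  apply (stalkMap_faithfullyFlat f x).injective
  exact (f.germ_stalkMap_apply V x hy s).trans
    ((congrArg _ hst).trans (f.germ_stalkMap_apply V x hy t).symm)

theorem flat_of_flat_of_faithfullyFlat (A B C : Type*) [CommRing A] [CommRing B] [CommRing C]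
    [Algebra A B] [Algebra B C] [Algebra A C] [IsScalarTower A B C] [Module.Flat A C]
    [Module.FaithfullyFlat B C] : Module.Flat A B := by
  rw [Module.Flat.iff_lTensor_preserves_injective_linearMap]
  intro N N' _ _ _ _ φ hφ
  have cancel := congrArg DFunLike.coe
    (TensorProduct.AlgebraTensorModule.lTensor_comp_cancelBaseChange A B B (M := C) φ)
  have : Function.Injective ((TensorProduct.AlgebraTensorModule.lTensor B B φ).lTensor C) := by
    refine .of_comp (f := TensorProduct.AlgebraTensorModule.cancelBaseChange A B B C N') ?_
    refine (congrArg Function.Injective cancel).mp ?_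
    exact (Module.Flat.lTensor_preserves_injective_linearMap (M := C) φ hφ).comp
      (LinearEquiv.injective _)
  exact (Module.FaithfullyFlat.lTensor_injective_iff_injective B C _).1 this

theorem flat_of_flat_comp_of_surjective (f : X ⟶ Y) (g : Y ⟶ Z) [Flat f] [Surjective f]
    [Flat (f ≫ g)] : Flat g := by
  refine Flat.of_stalkMap _ fun y => ?_
  obtain ⟨x, rfl⟩ := f.surjective y
  have stalk_faithfullyFlat := stalkMap_faithfullyFlat f x
  have stalk_comp_flat := Flat.stalkMap (f ≫ g) x
  rw [Scheme.Hom.stalkMap_comp] at stalk_comp_flat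
  algebraize [(f.stalkMap x).hom, (g.stalkMap (f x)).hom,
    ((f.stalkMap x).hom.comp (g.stalkMap (f x)).hom)]
  have : Module.Flat (Z.presheaf.stalk (g (f x))) (X.presheaf.stalk x) := stalk_comp_flat
  exact flat_of_flat_of_faithfullyFlat _ (Y.presheaf.stalk (f x)) (X.presheaf.stalk x)

theorem locallyOfFiniteType_of_comp_of_isFinite [IsLocallyNoetherian Z] (f : X ⟶ Y) (g : Y ⟶ Z)
    [Flat f] [Surjective f] [IsFinite f] [LocallyOfFiniteType (f ≫ g)] :
    LocallyOfFiniteType g := by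
  refine ⟨fun {U} hU {V} hV hVU => ?_⟩
  have appLE_comp : (f ≫ g).appLE U (f ⁻¹ᵁ V) (fun _ hx => hVU hx) =
      g.appLE U V hVU ≫ f.app V := by
    simp [Scheme.Hom.appLE]
  have comp_finiteType : ((f ≫ g).appLE U (f ⁻¹ᵁ V) (fun _ hx => hVU hx)).hom.FiniteType :=
    (f ≫ g).finiteType_appLE hU (hV.preimage f) _
  rw [appLE_comp, CommRingCat.hom_comp] at comp_finiteType
  have app_finite : (f.app V).hom.Finite := f.finite_app V hV
  have : IsNoetherianRing Γ(Z, U) := IsLocallyNoetherian.component_noetherian ⟨U, hU⟩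
  algebraize [(g.appLE U V hVU).hom, (f.app V).hom, ((f.app V).hom.comp (g.appLE U V hVU).hom)]
  -- Artin–Tate
  exact ⟨fg_of_fg_of_fg Γ(Z, U) Γ(Y, V) Γ(X, f ⁻¹ᵁ V) Algebra.FiniteType.out
    Module.Finite.fg_top (app_injective_of_flat_of_surjective f V)⟩

theorem isSeparated_of_comp_of_surjective (f : X ⟶ Y) (g : Y ⟶ Z) [Surjective f]
    [UniversallyClosed f] [IsSeparated (f ≫ g)] : IsSeparated g := by
  let map := pullback.map (f ≫ g) (f ≫ g) g g f f (𝟙 Z) (by simp) (by simp)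
  have diagonal_map : f ≫ pullback.diagonal g = pullback.diagonal (f ≫ g) ≫ map := by
    ext
    · rw [Category.assoc, Category.assoc, pullback.diagonal_fst, pullback.lift_fst,
        pullback.diagonal_fst_assoc, Category.comp_id]
    · rw [Category.assoc, Category.assoc, pullback.diagonal_snd, pullback.lift_snd,
        pullback.diagonal_snd_assoc, Category.comp_id]
  have : UniversallyClosed map :=
    MorphismProperty.pullbackMap (P := @UniversallyClosed) inferInstance inferInstance rfl rfl
  have : UniversallyClosed (f ≫ pullback.diagonal g) := diagonal_map ▸ inferInstance
  have : UniversallyClosed (pullback.diagonal g) := .of_comp_surjective f _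
  exact isSeparated_of_universallyClosed_diagonal g

theorem isFinite_of_isFinite_comp [IsLocallyNoetherian Z] (f : X ⟶ Y) (g : Y ⟶ Z)
    [Flat f] [Surjective f] [IsFinite f] [IsFinite (f ≫ g)] : IsFinite g := by
  have : LocallyOfFiniteType g := locallyOfFiniteType_of_comp_of_isFinite f g
  have : UniversallyClosed g := .of_comp_surjective f g
  have : IsSeparated g := isSeparated_of_comp_of_surjective f g
  have : IsProper g := {}
  refine isFinite_of_isProper_of_finite_preimage_singleton g fun z => ?_
  refine (((f ≫ g).finite_preimage_singleton z).image f).subset fun y hy => ?_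
  obtain ⟨x, rfl⟩ := f.surjective y
  exact ⟨x, by simpa using hy, rfl⟩

end Descent

section PiInteger

variable {R : Type*} [CommRing R] [IsDedekindDomain R] (v : HeightOneSpectrum R)

theorem exists_span_singleton_eq_pow [Finite (ClassGroup R)] :
    ∃ (a : R) (n : ℕ), n ≠ 0 ∧ Ideal.span {a} = v.asIdeal ^ n := by
  have class_pow : ClassGroup.mk0 (⟨v.asIdeal, mem_nonZeroDivisors_of_ne_zero v.ne_bot⟩ :
      nonZeroDivisors (Ideal R)) ^ Nat.card (ClassGroup R) = 1 := pow_card_eq_one'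
  rw [← map_pow, ClassGroup.mk0_eq_one_iff] at class_pow
  obtain ⟨a, ha⟩ := class_pow.principal
  exact ⟨a, _, Nat.card_pos.ne', ha.symm⟩

section

variable {v} {a : R} {n : ℕ}

theorem ne_zero_of_span_singleton_eq_pow (ha : Ideal.span {a} = v.asIdeal ^ n) : a ≠ 0 := by
  rintro rfl
  rw [Ideal.span_singleton_eq_bot.2 rfl] at ha
  exact pow_ne_zero n v.ne_bot ha.symm

variable (K : Type*) [Field K] [Algebra R K] [IsFractionRing R K]

theorem valuation_eq_one_of_span_singleton_eq_pow (ha : Ideal.span {a} = v.asIdeal ^ n)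
    {w : HeightOneSpectrum R} (hw : w ≠ v) : w.valuation K (algebraMap R K a) = 1 := by
  rw [w.valuation_eq_one_iff_notMem]
  intro hmem
  have pow_le : v.asIdeal ^ n ≤ w.asIdeal := by
    rwa [← ha, Ideal.span_singleton_le_iff_mem]
  have v_le_w : v.asIdeal ≤ w.asIdeal := w.isPrime.le_of_pow_le pow_le
  exact hw (HeightOneSpectrum.ext (v.isMaximal.eq_of_le w.isPrime.ne_top v_le_w).symm)

theorem exists_mul_pow_mem_range_of_span_singleton_eq_pow (hn : n ≠ 0)
    (ha : Ideal.span {a} = v.asIdeal ^ n) {x : K}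
    (hx : x ∈ ({v} : Set (HeightOneSpectrum R)).integer K) :
    ∃ m : ℕ, x * algebraMap R K a ^ m ∈ (algebraMap R K).range := by
  have a_mem : a ∈ v.asIdeal :=
    Ideal.pow_le_self hn (ha ▸ Ideal.mem_span_singleton_self a)
  have val_lt_one : v.valuation K (algebraMap R K a) < 1 := (v.valuation_lt_one_iff_mem a).2 a_mem
  have val_ne_zero : v.valuation K (algebraMap R K a) ≠ 0 := by
    simpa using ne_zero_of_span_singleton_eq_pow ha
  obtain ⟨m, hm⟩ := MulArchimedean.arch (v.valuation K x)
    ((one_lt_inv₀ (zero_lt_iff.2 val_ne_zero)).2 val_lt_one)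
  refine ⟨m, HeightOneSpectrum.mem_integers_of_valuation_le_one K _ fun w => ?_⟩
  rw [map_mul, map_pow]
  obtain rfl | hw := eq_or_ne w v
  · rw [inv_pow] at hm
    exact (le_mul_inv_iff₀ (pow_pos (zero_lt_iff.2 val_ne_zero) m)).1 (by rwa [one_mul])
  · rw [valuation_eq_one_of_span_singleton_eq_pow K ha hw, one_pow, mul_one]
    exact hx w hw

theorem isLocalizationAway_integer_of_span_singleton_eq_pow (hn : n ≠ 0)
    (ha : Ideal.span {a} = v.asIdeal ^ n) :
    IsLocalization.Away a (({v} : Set (HeightOneSpectrum R)).integer K) := by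
  refine IsLocalization.Away.mk a ?_ (fun x => ?_) fun b c hbc => ⟨0, ?_⟩
  · have haK : algebraMap R K a ≠ 0 := by
      simpa using ne_zero_of_span_singleton_eq_pow ha
    refine isUnit_iff_exists_inv.2 ⟨⟨(algebraMap R K a)⁻¹, fun w hw => ?_⟩,
      Subtype.ext (mul_inv_cancel₀ haK)⟩
    rw [map_inv₀, valuation_eq_one_of_span_singleton_eq_pow K ha hw, inv_one]
  · obtain ⟨m, b, hb⟩ := exists_mul_pow_mem_range_of_span_singleton_eq_pow K hn ha x.2
    exact ⟨m, b, Subtype.ext hb.symm⟩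
  · rw [FaithfulSMul.algebraMap_injective R K (congrArg Subtype.val hbc)]

end

theorem isNoetherianRing_integer_singleton [Finite (ClassGroup R)] (K : Type*) [Field K]
    [Algebra R K] [IsFractionRing R K] :
    IsNoetherianRing (({v} : Set (HeightOneSpectrum R)).integer K) := by
  obtain ⟨a, n, hn, ha⟩ := exists_span_singleton_eq_pow v
  have := isLocalizationAway_integer_of_span_singleton_eq_pow K hn ha
  exact IsLocalization.isNoetherianRing (Submonoid.powers a) _ inferInstance

end PiInteger

section GroupExtensions

variable {N J Q : Type*} [Group N] [Group J] [Group Q] {f : N →* J} {g : J →* Q}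

theorem card_eq_mul_of_mulExact (hf : Function.Injective f) (hg : Function.Surjective g)
    (h : Function.MulExact f g) : Nat.card J = Nat.card N * Nat.card Q := by
  rw [← g.ker.card_mul_index, Subgroup.index_ker, MonoidHom.mulExact_iff.1 h,
    MonoidHom.range_eq_top.2 hg, Subgroup.card_top,
    ← Nat.card_congr (MonoidHom.ofInjective hf).toEquiv]

theorem mulAut_pow_apply_eq_mul_pow (φ : MulAut J) {x z : J} (hx : φ x = x * z) (hz : φ z = z)
    (n : ℕ) : (φ ^ n) x = x * z ^ n := by
  induction n with
  | zero => simp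
  | succ n ih =>
    rw [pow_succ', MulAut.mul_apply, ih, map_mul, hx, map_pow, hz, mul_assoc, ← pow_succ']

/-- `x⁻¹ * φ x` comes from an element of `N`, fixed by `φ` and killed by the order of `N`. -/
theorem mulAut_pow_card_apply_eq_self (h : Function.MulExact f g) (φ : MulAut J)
    (hN : ∀ z, φ (f z) = f z) (hQ : ∀ x, g (φ x) = g x) (x : J) :
    (φ ^ Nat.card N) x = x := by
  obtain ⟨z, hz⟩ := (h (x⁻¹ * φ x)).1 (by rw [map_mul, map_inv, hQ, inv_mul_cancel])
  rw [mulAut_pow_apply_eq_mul_pow φ (z := f z) (by rw [hz, mul_inv_cancel_left]) (hN z),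
    ← map_pow, pow_card_eq_one', map_one, mul_one]

end GroupExtensions

section GroupObjects

variable {C : Type*} [Category* C] [CartesianMonoidalCategory C] {N J Q : C}
  {f : N ⟶ J} {g : J ⟶ Q}

/-- The action `N × J → J` of the kernel `N` of `g : J → Q` makes `J` a torsor over `Q`. -/
theorem isPullback_fst_of_isKernel [GrpObj J] [GrpObj Q] [IsMonHom g]
    (h : IsPullback f (toUnit N) g η[Q]) :
    IsPullback (fst J N) (fst J N * snd J N ≫ f) g g := by
  have comp_eq_one : f ≫ g = 1 := h.w
  refine ⟨⟨?_⟩, ⟨Limits.PullbackCone.IsLimit.mk _ (fun s => lift s.fst (h.lift (s.fst⁻¹ * s.snd)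
    (toUnit _) ?_)) (fun s => by simp) (fun s => ?_) fun s m hfst hsnd => ?_⟩⟩
  · rw [MonObj.mul_comp, Category.assoc, comp_eq_one, MonObj.comp_one, mul_one]
  · rw [MonObj.mul_comp, GrpObj.inv_comp, s.condition, inv_mul_cancel]
    rfl
  · rw [MonObj.comp_mul, lift_fst, lift_snd_assoc, h.lift_fst, mul_inv_cancel_left]
  · rw [MonObj.comp_mul, hfst] at hsnd
    apply CartesianMonoidalCategory.hom_ext
    · rw [hfst, lift_fst]
    · rw [lift_snd]
      refine h.hom_ext ?_ (toUnit_unique _ _)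
      rw [h.lift_fst, ← hsnd, inv_mul_cancel_left, Category.assoc]

variable [MonObj N] [MonObj J] [MonObj Q] [IsMonHom f]

theorem monoidHom_injective_of_isKernel (h : IsPullback f (toUnit N) g η[Q]) (T : C) :
    Function.Injective (IsMonHom.monoidHom f T) :=
  fun _ _ hab => h.hom_ext hab (toUnit_unique _ _)

theorem mulExact_monoidHom_of_isKernel [IsMonHom g]
    (h : IsPullback f (toUnit N) g η[Q]) (T : C) :
    Function.MulExact (IsMonHom.monoidHom f T) (IsMonHom.monoidHom g T) := by
  refine fun x => ⟨fun hx => ⟨h.lift x (toUnit _) hx, h.lift_fst _ _ _⟩, ?_⟩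
  rintro ⟨z, rfl⟩
  have comp_eq_one : f ≫ g = 1 := h.w
  change (z ≫ f) ≫ g = 1
  rw [Category.assoc, comp_eq_one, MonObj.comp_one]

end GroupObjects

theorem exists_comp_eq_of_surjective {k : Type u} [Field k] [IsAlgClosed k] {X Y : Scheme.{u}}
    (g : X ⟶ Y) [LocallyOfFiniteType g] [Surjective g] (p : Spec (CommRingCat.of k) ⟶ Y) :
    ∃ t : Spec (CommRingCat.of k) ⟶ X, t ≫ g = p := by
  let q := Limits.pullback.snd g p
  have : JacobsonSpace (Limits.pullback g p :) := LocallyOfFiniteType.jacobsonSpace q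
  obtain ⟨z, -⟩ := q.surjective default
  obtain ⟨x, -, hx⟩ :=
    nonempty_inter_closedPoints ⟨z, Set.mem_univ z⟩ isClosed_univ.isLocallyClosed
  refine ⟨pointOfClosedPoint q x hx ≫ Limits.pullback.fst g p, ?_⟩
  rw [Category.assoc, Limits.pullback.condition]
  exact pointOfClosedPoint_comp_assoc q x hx p

section PiIntegers

variable {K : Type u} [Field K] [NumberField K] {π : HeightOneSpectrum (𝓞 K)}

namespace CommGroupScheme

/-- The homomorphism `G(K̄) → H(K̄)` on geometric points induced by a homomorphism `G → H` of
group schemes. -/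
noncomputable abbrev pointsMap {G H : CommGroupScheme π} (f : G ⟶ H) :
    (geometricPoint π ⟶ G.X) →* (geometricPoint π ⟶ H.X) :=
  IsMonHom.monoidHom f.hom.hom.hom (geometricPoint π)

variable {G H : CommGroupScheme π}

theorem pointsMap_galoisRep (f : G ⟶ H) (σ : AlgebraicClosure K ≃ₐ[K] AlgebraicClosure K)
    (P : geometricPoint π ⟶ G.X) :
    pointsMap f (galoisRep G σ P) = galoisRep H σ (pointsMap f P) :=
  Category.assoc (geometricPointMap π σ) P f.hom.hom.hom

theorem pointsMap_injective (f : G ⟶ H) [Mono (homLeft f)] :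
    Function.Injective (pointsMap f) := fun _ _ hPQ =>
  Over.OverMorphism.ext ((cancel_mono (homLeft f)).1 (congrArg CommaMorphism.left hPQ))

theorem homLeft_comp_hom (f : G ⟶ H) : homLeft f ≫ H.X.hom = G.X.hom :=
  Over.w f.hom.hom.hom

theorem pointsMap_surjective (f : G ⟶ H) [LocallyOfFiniteType (homLeft f)]
    [Surjective (homLeft f)] : Function.Surjective (pointsMap f) := by
  intro P
  obtain ⟨t, ht⟩ := exists_comp_eq_of_surjective (homLeft f) (k := AlgebraicClosure K) P.left
  have ht_over : t ≫ G.X.hom = (geometricPoint π).hom := by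
    rw [← homLeft_comp_hom f, ← Category.assoc, ht]
    exact Over.w P
  exact ⟨Over.homMk t ht_over, Over.OverMorphism.ext ht⟩

theorem finrank_eq_card_points [IsFinite G.X.hom] [Flat G.X.hom]
    (s : Spec (CommRingCat.of (PiInteger π))) :
    G.X.hom.finrank s = Nat.card (geometricPoint π ⟶ G.X) :=
  have := isNoetherianRing_integer_singleton π K
  _root_.finrank_eq_card_points (AlgebraicClosure K) G.X s

theorem isRamifiedOfLevelAt_iff {i : ℝ} :
    G.IsRamifiedOfLevelAt π i ↔
      ∀ (e : AlgebraicClosure K →ₐ[K] AlgebraicClosure (π.adicCompletion K)) (v : ℝ), i < v →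
        ∀ σ ∈ absoluteUpperRamificationGroup (π.adicCompletionIntegers K) (π.adicCompletion K) v,
          ∀ P : geometricPoint π ⟶ G.X, galoisRep G (galoisRestrict e σ) P = P :=
  forall₃_congr fun e _ _ => forall₂_congr fun _ _ =>
    (MonoidHom.mem_ker (f := (galoisRep G).comp (galoisRestrict e))).trans MulEquiv.ext_iff

theorem IsRamifiedOfLevelAt.of_injective {i : ℝ} (f : G ⟶ H)
    (hf : Function.Injective (pointsMap f)) (h : H.IsRamifiedOfLevelAt π i) :
    G.IsRamifiedOfLevelAt π i := by
  rw [isRamifiedOfLevelAt_iff] at h ⊢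
  intro e v hv σ hσ P
  apply hf
  rw [pointsMap_galoisRep, h e v hv σ hσ]

theorem IsRamifiedOfLevelAt.of_surjective {i : ℝ} (f : G ⟶ H)
    (hf : Function.Surjective (pointsMap f)) (h : G.IsRamifiedOfLevelAt π i) :
    H.IsRamifiedOfLevelAt π i := by
  rw [isRamifiedOfLevelAt_iff] at h ⊢
  intro e v hv σ hσ P
  obtain ⟨P, rfl⟩ := hf P
  rw [← pointsMap_galoisRep, h e v hv σ hσ]

theorem exists_galoisRep_eq_iff [IsAffineHom G.X.hom] (P : geometricPoint π ⟶ G.X) :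
    ∃ T : Set (AlgebraicClosure K), ∀ σ : AlgebraicClosure K ≃ₐ[K] AlgebraicClosure K,
      galoisRep G σ P = P ↔ ∀ y ∈ T, σ y = y := by
  obtain ⟨T, hT⟩ := exists_specOverMap_comp_eq_iff (k := AlgebraicClosure K) G.X P
  exact ⟨T, fun σ => hT ((σ : AlgebraicClosure K →ₐ[K] AlgebraicClosure K).restrictScalars _)⟩

theorem galoisRep_eq_of_galoisRep_pow_eq [IsAffineHom G.X.hom]
    (e : AlgebraicClosure K →ₐ[K] AlgebraicClosure (π.adicCompletion K)) {v : ℝ} (hv : 0 < v)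
    {σ : AlgebraicClosure (π.adicCompletion K) ≃ₐ[π.adicCompletion K]
      AlgebraicClosure (π.adicCompletion K)}
    (hσ : σ ∈ absoluteUpperRamificationGroup (π.adicCompletionIntegers K) (π.adicCompletion K) v)
    {m : ℕ} (hm : (m : 𝓞 K) ∉ π.asIdeal) {P : geometricPoint π ⟶ G.X}
    (hP : galoisRep G (galoisRestrict e σ ^ m) P = P) :
    galoisRep G (galoisRestrict e σ) P = P := by
  obtain ⟨T, hT⟩ := exists_galoisRep_eq_iff P
  rw [hT] at hP ⊢
  intro y hy
  apply e.toRingHom.injective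
  refine (galoisRestrict_commutes e σ y).trans ?_
  refine eq_of_pow_eq_of_mem_absoluteUpperRamificationGroup hv hσ
    (isUnit_natCast_adicCompletionIntegers K π hm) ?_
  rw [← galoisRestrict_commutes, map_pow]
  exact congrArg e (hP y hy)

end CommGroupScheme

open CommGroupScheme

namespace IsShortExactSeq

variable {N J Q : CommGroupScheme π} {f : N ⟶ J} {g : J ⟶ Q}

theorem isFinite_homLeft (h : IsShortExactSeq f g) (hN : IsFinite N.X.hom) :
    IsFinite (homLeft g) := by
  have torsor : IsPullback (Limits.pullback.fst J.X.hom N.X.hom)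
      (fst J.X N.X * snd J.X N.X ≫ f.hom.hom.hom).left (homLeft g) (homLeft g) :=
    (isPullback_fst_of_isKernel h.isKernel).map (Over.forget _)
  have := h.flat
  have := h.surjective
  have := h.quasiCompact
  exact isFinite_of_isPullback torsor

theorem mulExact_pointsMap (h : IsShortExactSeq f g) :
    Function.MulExact (pointsMap f) (pointsMap g) :=
  mulExact_monoidHom_of_isKernel h.isKernel _

theorem card_points_eq_mul (h : IsShortExactSeq f g) (hN : IsFinite N.X.hom) :
    Nat.card (geometricPoint π ⟶ J.X) =
      Nat.card (geometricPoint π ⟶ N.X) * Nat.card (geometricPoint π ⟶ Q.X) :=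
  have := h.isFinite_homLeft hN
  have := h.surjective
  card_eq_mul_of_mulExact (monoidHom_injective_of_isKernel h.isKernel _)
    (pointsMap_surjective g) h.mulExact_pointsMap

theorem isRamifiedOfLevelAt (h : IsShortExactSeq f g) [IsAffineHom J.X.hom]
    (hcard : (Nat.card (geometricPoint π ⟶ N.X) : 𝓞 K) ∉ π.asIdeal) {i : ℝ} (hi : 0 ≤ i)
    (hN : N.IsRamifiedOfLevelAt π i) (hQ : Q.IsRamifiedOfLevelAt π i) :
    J.IsRamifiedOfLevelAt π i := by
  rw [isRamifiedOfLevelAt_iff] at hN hQ ⊢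
  intro e v hv σ hσ P
  refine galoisRep_eq_of_galoisRep_pow_eq e (hi.trans_lt hv) hσ hcard ?_
  rw [map_pow]
  refine mulAut_pow_card_apply_eq_self h.mulExact_pointsMap _ (fun Z => ?_) (fun P => ?_) P
  · rw [← pointsMap_galoisRep, hN e v hv σ hσ]
  · rw [pointsMap_galoisRep, hQ e v hv σ hσ]

theorem isFinite_middle (h : IsShortExactSeq f g) (hN : IsFinite N.X.hom)
    (hQ : IsFinite Q.X.hom) : IsFinite J.X.hom := by
  have := h.isFinite_homLeft hN
  rw [← homLeft_comp_hom g]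
  infer_instance

theorem flat_middle (h : IsShortExactSeq f g) (hQ : Flat Q.X.hom) : Flat J.X.hom := by
  have := h.flat
  rw [← homLeft_comp_hom g]
  infer_instance

theorem isFinite_right (h : IsShortExactSeq f g) (hN : IsFinite N.X.hom)
    (hJ : IsFinite J.X.hom) : IsFinite Q.X.hom := by
  have := h.isFinite_homLeft hN
  have := h.flat
  have := h.surjective
  have := isNoetherianRing_integer_singleton π K
  rw [← homLeft_comp_hom g] at hJ
  exact isFinite_of_isFinite_comp (homLeft g) Q.X.hom

theorem flat_right (h : IsShortExactSeq f g) (hJ : Flat J.X.hom) : Flat Q.X.hom := by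
  have := h.flat
  have := h.surjective
  rw [← homLeft_comp_hom g] at hJ
  exact flat_of_flat_comp_of_surjective (homLeft g) Q.X.hom

end IsShortExactSeq

namespace IsLevelGroupScheme

variable {ℓ : ℕ} {i : ℝ}

theorem exists_card_points_eq_pow {G : CommGroupScheme π} (h : IsLevelGroupScheme π ℓ i G) :
    ∃ n, Nat.card (geometricPoint π ⟶ G.X) = ℓ ^ n := by
  obtain ⟨n, hn⟩ := h.order
  have := h.isFinite
  have := h.flat
  exact ⟨n, (finrank_eq_card_points (⊥ : PrimeSpectrum (PiInteger π))).symm.trans (hn _)⟩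

theorem of_card_points_eq_pow {G : CommGroupScheme π} [IsFinite G.X.hom] [Flat G.X.hom]
    (hcard : ∃ n, Nat.card (geometricPoint π ⟶ G.X) = ℓ ^ n)
    (hlevel : G.IsRamifiedOfLevelAt π i) : IsLevelGroupScheme π ℓ i G :=
  ⟨inferInstance, inferInstance,
    hcard.imp fun _ hn s => (finrank_eq_card_points s).trans hn, hlevel⟩

theorem of_isShortExactSeq {N J Q : CommGroupScheme π} {f : N ⟶ J} {g : J ⟶ Q}
    (h : IsShortExactSeq f g) (hℓ : (ℓ : 𝓞 K) ∉ π.asIdeal) (hi : 0 ≤ i)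
    (hN : IsLevelGroupScheme π ℓ i N) (hQ : IsLevelGroupScheme π ℓ i Q) :
    IsLevelGroupScheme π ℓ i J := by
  have := h.isFinite_middle hN.isFinite hQ.isFinite
  have := h.flat_middle hQ.flat
  obtain ⟨a, ha⟩ := hN.exists_card_points_eq_pow
  obtain ⟨b, hb⟩ := hQ.exists_card_points_eq_pow
  have hcard : (Nat.card (geometricPoint π ⟶ N.X) : 𝓞 K) ∉ π.asIdeal := by
    rw [ha, Nat.cast_pow]
    exact fun hmem => hℓ (π.isPrime.mem_of_pow_mem a hmem)
  refine of_card_points_eq_pow ⟨a + b, ?_⟩ (h.isRamifiedOfLevelAt hcard hi hN.level hQ.level)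
  rw [h.card_points_eq_mul hN.isFinite, ha, hb, pow_add]

variable {J : CommGroupScheme π}

theorem exists_eq_pow_of_dvd_card_points (hJ : IsLevelGroupScheme π ℓ i J) (hℓ : ℓ.Prime)
    {c : ℕ} (hc : c ∣ Nat.card (geometricPoint π ⟶ J.X)) : ∃ n, c = ℓ ^ n := by
  obtain ⟨m, hm⟩ := hJ.exists_card_points_eq_pow
  rw [hm, Nat.dvd_prime_pow hℓ] at hc
  exact hc.imp fun _ hn => hn.2

theorem of_mono (hJ : IsLevelGroupScheme π ℓ i J) (hℓ : ℓ.Prime) {H : CommGroupScheme π}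
    (f : H ⟶ J) [Mono (homLeft f)] [IsFinite H.X.hom] [Flat H.X.hom] :
    IsLevelGroupScheme π ℓ i H :=
  have injective := pointsMap_injective f
  of_card_points_eq_pow
    (hJ.exists_eq_pow_of_dvd_card_points hℓ (Subgroup.card_dvd_of_injective _ injective))
    (.of_injective f injective hJ.level)

theorem quotient (hJ : IsLevelGroupScheme π ℓ i J) (hℓ : ℓ.Prime) {N Q : CommGroupScheme π}
    {f : N ⟶ J} {g : J ⟶ Q} (h : IsShortExactSeq f g) (hN : IsFinite N.X.hom) :
    IsLevelGroupScheme π ℓ i Q :=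
  have := h.isFinite_homLeft hN
  have := h.surjective
  have := h.isFinite_right hN hJ.isFinite
  have := h.flat_right hJ.flat
  have surjective := pointsMap_surjective g
  of_card_points_eq_pow
    (hJ.exists_eq_pow_of_dvd_card_points hℓ (Subgroup.card_dvd_of_surjective _ surjective))
    (.of_surjective g surjective hJ.level)

end IsLevelGroupScheme

end PiIntegers

theorem proposition2p6 {K : Type*} [Field K] [NumberField K] (π : HeightOneSpectrum (𝓞 K))
    (ℓ : ℕ) (hℓ : ℓ.Prime) (hπℓ : (ℓ : 𝓞 K) ∉ π.asIdeal) (i : ℝ) (hi : 0 ≤ i) :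
    (∀ (J'' J J' : CommGroupScheme π) (f : J'' ⟶ J) (g : J ⟶ J'), IsShortExactSeq f g →
      IsLevelGroupScheme π ℓ i J'' → IsLevelGroupScheme π ℓ i J' →
        IsLevelGroupScheme π ℓ i J) ∧
    (∀ (H J : CommGroupScheme π) (f : H ⟶ J), IsClosedImmersion (CommGroupScheme.homLeft f) →
      Flat H.X.hom → IsLevelGroupScheme π ℓ i J →
        IsLevelGroupScheme π ℓ i H ∧
        ∀ (Q : CommGroupScheme π) (g : J ⟶ Q), IsShortExactSeq f g →
          IsLevelGroupScheme π ℓ i Q) := by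
  refine ⟨fun _ _ _ _ _ h hN hQ => .of_isShortExactSeq h hπℓ hi hN hQ,
    fun H J f hf hflat hJ => ?_⟩
  have hH : IsFinite H.X.hom := by
    have := hJ.isFinite
    rw [← CommGroupScheme.homLeft_comp_hom f]
    infer_instance
  exact ⟨hJ.of_mono hℓ f, fun Q g h => hJ.quotient hℓ h hH⟩
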